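/- Let $m\ge 0$ and $N\ge 1$ be integers, let $p,q\in[1,\infty]$ satisfy $1/p+1/q=1$, and let $\hat\xi_1,\dots,\hat\xi_N\in\mathbb{R}^m$, $x\in\mathbb{R}^m$, $\alpha\in\mathbb{R}$, $\varepsilon\ge 0$. Put $\hat\mu=\frac1N\sum_{i=1}^N\hat\xi_i$ and $\widehat{\mathbb P}_N=\frac1N\sum_{i=1}^N\delta_{\hat\xi_i}$. Let $\mathcal M(\mathbb{R}^m)$ be the set of Borel probability measures $\mathbb P$ on $\mathbb{R}^m$ with $\int\|\xi\|_p\,\mathbb P(d\xi)<\infty$, let $$d_W(\mathbb P_1,\mathbb P_2)=\inf_{\mathbb Q}\int_{\mathbb{R}^m\times\mathbb{R}^m}\|\xi_1-\xi_2\|_p\,\mathbb Q(d\xi_1,d\xi_2),$$ the infimum being over all Borel probability measures $\mathbb Q$ on $\mathbb{R}^m\times\mathbb{R}^m$ with marginals $\mathbb P_1$ and $\mathbb P_2$, and let $\mathcal U_\varepsilon(\widehat{\mathbb P}_N)=\{\mathbb P\in\mathcal M(\mathbb{R}^m): d_W(\mathbb P,\widehat{\mathbb P}_N)\le\varepsilon\}$.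 Then the optimal value (supremum) $$\sup\bigl\{\mathbb E_{\mathbb P}[\max(0,\alpha-\xi^\top x)] : \mathbb P\in\mathcal U_\varepsilon(\widehat{\mathbb P}_N),\ \mathbb E_{\mathbb P}(\xi^\top x)=\alpha\bigr\}$$ is equal to the optimal value (infimum) of the problem $$\inf_{\gamma_1,\gamma_2\in\mathbb{R}}\ \gamma_1(\alpha-\hat\mu^\top x)+\gamma_2\varepsilon+\frac1N\sum_{i=1}^N\max(0,\alpha-\hat\xi_i^\top x)\quad\text{s.t.}\quad \|\gamma_1x\|_q\le\gamma_2,\ \ \|\gamma_1x+x\|_q\le\gamma_2,$$ and the latter is a convex program (its feasible set and its objective function are convex). Both optimal values are taken in $[-\infty,\infty]$, with $\sup\emptyset=-\infty$. -/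

import Mathlib

open MeasureTheory
open scoped ENNReal

namespace DRO

noncomputable section

/-- The `p`-norm of a vector of `ℝ^m`, for `p ∈ [1, ∞]`. -/
def pNorm {m : ℕ} (p : ℝ≥0∞) (v : Fin m → ℝ) : ℝ :=
  ‖(WithLp.toLp p v : PiLp p (fun _ : Fin m => ℝ))‖

/-- `𝓜(ℝ^m)`: the Borel probability measures on `ℝ^m` whose first moment
`∫ ‖ξ‖_p P(dξ)` is finite. -/
def probMeasures (m : ℕ) (p : ℝ≥0∞) : Set (Measure (Fin m → ℝ)) :=
  {P | IsProbabilityMeasure P ∧ Integrable (fun ξ => pNorm p ξ) P}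

/-- The joint distributions on `ℝ^m × ℝ^m` with first marginal `P₁` and second marginal `P₂`. -/
def couplings {m : ℕ} (P₁ P₂ : Measure (Fin m → ℝ)) :
    Set (Measure ((Fin m → ℝ) × (Fin m → ℝ))) :=
  {Q | IsProbabilityMeasure Q ∧ Q.map Prod.fst = P₁ ∧ Q.map Prod.snd = P₂}

/-- The Wasserstein metric (of order one) with transportation cost `‖ξ₁ - ξ₂‖_p`. -/
def wasserstein {m : ℕ} (p : ℝ≥0∞) (P₁ P₂ : Measure (Fin m → ℝ)) : ℝ≥0∞ :=
  ⨅ Q ∈ couplings P₁ P₂, ∫⁻ z, ENNReal.ofReal (pNorm p (z.1 - z.2)) ∂Q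

/-- The empirical distribution `(1/N) ∑ δ_{ξ̂ i}`. -/
def empirical {m N : ℕ} (ξhat : Fin N → Fin m → ℝ) : Measure (Fin m → ℝ) :=
  (N : ℝ≥0∞)⁻¹ • ∑ i, Measure.dirac (ξhat i)

/-- The empirical mean `(1/N) ∑ ξ̂ i`. -/
def empiricalMean {m N : ℕ} (ξhat : Fin N → Fin m → ℝ) : Fin m → ℝ :=
  (N : ℝ)⁻¹ • ∑ i, ξhat i

/-- The Wasserstein ambiguity set: the ball of radius `ε` around the empirical distribution. -/
def ambiguitySet {m N : ℕ} (p : ℝ≥0∞) (ξhat : Fin N → Fin m → ℝ) (ε : ℝ) :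
    Set (Measure (Fin m → ℝ)) :=
  {P | P ∈ probMeasures m p ∧ wasserstein p P (empirical ξhat) ≤ ENNReal.ofReal ε}

/-- The feasible distributions of the worst-case problem: those in the ambiguity set with
`E_P(ξᵀx) = α`. -/
def innerFeasible {m N : ℕ} (p : ℝ≥0∞) (ξhat : Fin N → Fin m → ℝ) (ε : ℝ)
    (x : Fin m → ℝ) (α : ℝ) : Set (Measure (Fin m → ℝ)) :=
  {P | P ∈ ambiguitySet p ξhat ε ∧ ∫ ξ, ξ ⬝ᵥ x ∂P = α}

/-- The optimal value, in the extended reals, of maximizing `E_P[max(0, α - ξᵀx)]` over the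
feasible distributions; it is `-∞` if there is none. -/
def innerValue {m N : ℕ} (p : ℝ≥0∞) (ξhat : Fin N → Fin m → ℝ) (ε : ℝ)
    (x : Fin m → ℝ) (α : ℝ) : EReal :=
  ⨆ P ∈ innerFeasible p ξhat ε x α, ((∫ ξ, max 0 (α - ξ ⬝ᵥ x) ∂P : ℝ) : EReal)

/-- The feasible pairs `(γ₁, γ₂)` of the finite-dimensional program. -/
def conicFeasible {m : ℕ} (q : ℝ≥0∞) (x : Fin m → ℝ) : Set (ℝ × ℝ) :=
  {γ | pNorm q (γ.1 • x) ≤ γ.2 ∧ pNorm q (γ.1 • x + x) ≤ γ.2}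

/-- The objective function of the finite-dimensional program. -/
def conicObjective {m N : ℕ} (ξhat : Fin N → Fin m → ℝ) (ε : ℝ)
    (x : Fin m → ℝ) (α : ℝ) (γ : ℝ × ℝ) : ℝ :=
  γ.1 * (α - empiricalMean ξhat ⬝ᵥ x) + γ.2 * ε
    + (N : ℝ)⁻¹ * ∑ i, max 0 (α - ξhat i ⬝ᵥ x)

/-- The optimal value, in the extended reals, of the finite-dimensional program; it is `-∞` if
the program is unbounded. -/
def conicValue {m N : ℕ} (q : ℝ≥0∞) (ξhat : Fin N → Fin m → ℝ) (ε : ℝ)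
    (x : Fin m → ℝ) (α : ℝ) : EReal :=
  ⨅ γ ∈ conicFeasible q x, (conicObjective ξhat ε x α γ : EReal)

end

end DRO

/-!
Write `t ξ = α - ξ ⬝ᵥ x`, `δ = α - empiricalMean ξhat ⬝ᵥ x` for the empirical mean of `t`,
`a = pNorm q x`, and `C` for the empirical mean of `max 0 t`.

Weak duality. On distributions with `E[t] = 0` the objective `E[max 0 t]` does not change when
`γ₁ * t` is added to the integrand. The function `max 0 t + γ₁ * t` is piecewise affine in `t` with
slopes `γ₁` and `γ₁ + 1`, so by Hölder's inequality the two conic constraints say that it is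
`γ₂`-Lipschitz for the `p`-norm (`lagrangian_sub_le`). Integrating the Lipschitz bound against an
almost optimal coupling with the empirical distribution bounds `E[max 0 t]` by the conic objective
(`integral_max_le_conicObjective`).

Strong duality. If `|δ| > ε * a` the finite-dimensional program is unbounded below
(`conicValue_eq_bot`), and nothing is left to prove. Otherwise `γ = (-1/2, a/2)` has the objective
value `C + (ε * a - δ) / 2`. This value is approached by primal feasible distributions: let `v` be
a vector of `p`-norm at most one with `v ⬝ᵥ x = a` (`exists_pNorm_le_one_dotProduct_eq`), and send
a vanishing share `η` of every atom far away along `-v` and another along `v`. The two transport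
budgets `U` and `D` are fixed by `U + D = ε` and by the mean constraint `(D - U) * a = δ`. A mass
`η` moved by `U / η` along `-v` gains almost `U * a` in `E[max 0 t]`
(`exists_innerFeasible_le_integral`), and `C + U * a` is the value above.
-/

namespace DRO

/-! ### The `p`-norm: duality and regularity -/

section Norm

variable {m : ℕ}

lemma pNorm_nonneg {p : ℝ≥0∞} [Fact (1 ≤ p)] (v : Fin m → ℝ) : 0 ≤ pNorm p v :=
  norm_nonneg _

lemma pNorm_smul {p : ℝ≥0∞} [Fact (1 ≤ p)] (c : ℝ) (v : Fin m → ℝ) :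
    pNorm p (c • v) = |c| * pNorm p v := by
  simp [pNorm, WithLp.toLp_smul, norm_smul]

lemma pNorm_add_le {p : ℝ≥0∞} [Fact (1 ≤ p)] (v w : Fin m → ℝ) :
    pNorm p (v + w) ≤ pNorm p v + pNorm p w := by
  simpa [pNorm, WithLp.toLp_add] using norm_add_le (WithLp.toLp p v) (WithLp.toLp p w)

lemma continuous_pNorm {p : ℝ≥0∞} [Fact (1 ≤ p)] :
    Continuous (pNorm p : (Fin m → ℝ) → ℝ) :=
  (PiLp.continuous_toLp p _).norm

lemma convexOn_pNorm {p : ℝ≥0∞} [Fact (1 ≤ p)] :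
    ConvexOn ℝ Set.univ (pNorm p : (Fin m → ℝ) → ℝ) := by
  refine ⟨convex_univ, fun v _ w _ a b ha hb _ => (pNorm_add_le _ _).trans_eq ?_⟩
  rw [pNorm_smul, pNorm_smul, abs_of_nonneg ha, abs_of_nonneg hb, smul_eq_mul, smul_eq_mul]

lemma pNorm_one_eq (v : Fin m → ℝ) : pNorm 1 v = ∑ i, |v i| := by
  simp [pNorm, PiLp.norm_eq_of_L1]

lemma pNorm_top_eq (v : Fin m → ℝ) : pNorm ∞ v = ‖v‖ := by
  simp [pNorm]

lemma pNorm_eq_sum {p : ℝ≥0∞} (hp : 0 < p.toReal) (v : Fin m → ℝ) :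
    pNorm p v = (∑ i, |v i| ^ p.toReal) ^ (1 / p.toReal) := by
  simp [pNorm, PiLp.norm_eq_sum hp]

lemma holderConjugate_cases {p q : ℝ≥0∞} (h : ENNReal.HolderConjugate p q) :
    p = 1 ∧ q = ∞ ∨ p = ∞ ∧ q = 1 ∨ p.toReal.HolderConjugate q.toReal := by
  rcases eq_or_ne p ∞ with rfl | hp
  · exact .inr (.inl ⟨rfl, ENNReal.HolderConjugate.unique ∞ q 1⟩)
  rcases eq_or_ne q ∞ with rfl | hq
  · have := h.symm
    exact .inl ⟨ENNReal.HolderConjugate.unique ∞ p 1, rfl⟩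
  · exact .inr (.inr (ENNReal.HolderConjugate.toReal_of_ne_top hp hq))

/-- The endpoint case of Hölder's inequality, with the sup norm on one side. -/
lemma dotProduct_le_norm_mul_sum (v w : Fin m → ℝ) : v ⬝ᵥ w ≤ ‖v‖ * ∑ i, |w i| := by
  rw [dotProduct, Finset.mul_sum]
  refine Finset.sum_le_sum fun i _ => (le_abs_self _).trans ?_
  rw [abs_mul]
  exact mul_le_mul_of_nonneg_right (norm_le_pi_norm v i) (abs_nonneg _)

/-- **Hölder's inequality**, the endpoints `p = 1` and `p = ∞` included. -/
lemma dotProduct_le_pNorm_mul_pNorm {p q : ℝ≥0∞} (h : ENNReal.HolderConjugate p q)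
    (v w : Fin m → ℝ) : v ⬝ᵥ w ≤ pNorm p v * pNorm q w := by
  rcases holderConjugate_cases h with ⟨rfl, rfl⟩ | ⟨rfl, rfl⟩ | h
  · rw [pNorm_one_eq, pNorm_top_eq, mul_comm, dotProduct_comm]
    exact dotProduct_le_norm_mul_sum w v
  · rw [pNorm_one_eq, pNorm_top_eq]
    exact dotProduct_le_norm_mul_sum v w
  · rw [pNorm_eq_sum h.pos, pNorm_eq_sum h.symm.pos]
    exact Real.inner_le_Lp_mul_Lq _ _ _ h


/-- The dual norm is attained: some vector of `p`-norm at most `1` is aligned with `x`. -/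
lemma exists_pNorm_le_one_dotProduct_eq {p q : ℝ≥0∞} (h : ENNReal.HolderConjugate p q)
    (x : Fin m → ℝ) : ∃ v, pNorm p v ≤ 1 ∧ v ⬝ᵥ x = pNorm q x := by
  have hsign (r : ℝ) : |(SignType.sign r : ℝ)| ≤ 1 := by
    rcases lt_trichotomy r 0 with hr | rfl | hr <;> simp [*]
  rcases holderConjugate_cases h with ⟨rfl, rfl⟩ | ⟨rfl, rfl⟩ | h
  · rcases isEmpty_or_nonempty (Fin m) with hm | hm
    · exact ⟨0, by simp [pNorm_one_eq], by simp [pNorm_top_eq, Subsingleton.elim x 0]⟩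
    obtain ⟨i, hi⟩ := Finite.exists_max fun i => |x i|
    refine ⟨Pi.single i (SignType.sign (x i) : ℝ), ?_, ?_⟩
    · rw [pNorm_one_eq, Finset.sum_eq_single i (fun j _ hj => by simp [hj]) (by simp)]
      simpa using hsign (x i)
    · rw [single_dotProduct, sign_mul_self, pNorm_top_eq]
      exact le_antisymm (norm_le_pi_norm x i) ((pi_norm_le_iff_of_nonneg (abs_nonneg _)).2 hi)
  · refine ⟨fun i => (SignType.sign (x i) : ℝ), ?_, ?_⟩
    · rw [pNorm_top_eq]
      exact (pi_norm_le_iff_of_nonneg zero_le_one).2 fun i => hsign (x i)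
    · simp [dotProduct, pNorm_one_eq, sign_mul_self]
  · obtain ⟨g, hg, hgx⟩ := (NNReal.isGreatest_Lp Finset.univ (fun i => Real.nnabs (x i)) h.symm).1
    refine ⟨fun i => (SignType.sign (x i) : ℝ) * g i, ?_, ?_⟩
    · rw [pNorm_eq_sum h.pos]
      refine Real.rpow_le_one (by positivity) ?_ (one_div_nonneg.2 h.nonneg)
      refine le_trans (Finset.sum_le_sum fun i _ => ?_) (NNReal.coe_le_coe.2 hg |>.trans_eq' ?_)
        (b := ∑ i, (g i : ℝ) ^ p.toReal)
      · gcongr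
        rw [abs_mul, NNReal.abs_eq]
        exact mul_le_of_le_one_left (g i).2 (hsign _)
      · push_cast; rfl
    · have := congrArg NNReal.toReal hgx
      push_cast at this
      rw [pNorm_eq_sum h.symm.pos, ← this]
      refine Finset.sum_congr rfl fun i _ => ?_
      rw [mul_right_comm, sign_mul_self]

end Norm

/-! ### Finitely supported measures -/

section Discrete

variable {κ Ω Ω' : Type*} [Fintype κ] [MeasurableSpace Ω] [MeasurableSpace Ω']

/-- The measure with mass `w k` at the point `z k`; negative weights count as zero. -/
noncomputable def discreteMeasure (w : κ → ℝ) (z : κ → Ω) : Measure Ω :=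
  ∑ k, ENNReal.ofReal (w k) • Measure.dirac (z k)

lemma map_discreteMeasure {f : Ω → Ω'} (hf : Measurable f) (w : κ → ℝ) (z : κ → Ω) :
    (discreteMeasure w z).map f = discreteMeasure w (f ∘ z) := by
  rw [discreteMeasure, ← Measure.mapₗ_apply_of_measurable hf, map_sum]
  refine Finset.sum_congr rfl fun k _ => ?_
  rw [map_smul, Measure.mapₗ_apply_of_measurable hf, Measure.map_dirac' hf, Function.comp_apply]

lemma isProbabilityMeasure_discreteMeasure {w : κ → ℝ} (hw : ∀ k, 0 ≤ w k) (h1 : ∑ k, w k = 1)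
    (z : κ → Ω) : IsProbabilityMeasure (discreteMeasure w z) := by
  constructor
  simp [discreteMeasure, ← ENNReal.ofReal_sum_of_nonneg fun k _ => hw k, h1]

/-- Atoms that share their position merge, their weights being added. -/
lemma discreteMeasure_comp_fst {κ' : Type*} [Fintype κ'] {w : κ × κ' → ℝ} (hw : ∀ k, 0 ≤ w k)
    (z : κ → Ω) :
    discreteMeasure w (fun k => z k.1) = discreteMeasure (fun k => ∑ l, w (k, l)) z := by
  simp only [discreteMeasure, Fintype.sum_prod_type]
  refine Finset.sum_congr rfl fun k _ => ?_
  rw [← Finset.sum_smul, ENNReal.ofReal_sum_of_nonneg fun l _ => hw (k, l)]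

variable [MeasurableSingletonClass Ω]

lemma integrable_discreteMeasure (w : κ → ℝ) (z : κ → Ω) (f : Ω → ℝ) :
    Integrable f (discreteMeasure w z) :=
  integrable_finsetSum_measure.2 fun _ _ =>
    (integrable_dirac enorm_lt_top).smul_measure ENNReal.ofReal_ne_top

lemma integral_discreteMeasure {w : κ → ℝ} (hw : ∀ k, 0 ≤ w k) (z : κ → Ω) (f : Ω → ℝ) :
    ∫ y, f y ∂discreteMeasure w z = ∑ k, w k * f (z k) := by
  rw [discreteMeasure, integral_finsetSum_measure fun _ _ =>
    (integrable_dirac enorm_lt_top).smul_measure ENNReal.ofReal_ne_top]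
  simp [integral_smul_measure, ENNReal.toReal_ofReal, hw]

end Discrete

variable {m N : ℕ}

lemma empirical_eq_discreteMeasure (hN : 0 < N) (ξhat : Fin N → Fin m → ℝ) :
    empirical ξhat = discreteMeasure (fun _ => (N : ℝ)⁻¹) ξhat := by
  have : ENNReal.ofReal (N : ℝ)⁻¹ = (N : ℝ≥0∞)⁻¹ := by
    rw [ENNReal.ofReal_inv_of_pos (by exact_mod_cast hN), ENNReal.ofReal_natCast]
  simp [empirical, discreteMeasure, this, Finset.smul_sum]

lemma integral_empirical (hN : 0 < N) (ξhat : Fin N → Fin m → ℝ) (f : (Fin m → ℝ) → ℝ) :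
    ∫ ξ, f ξ ∂empirical ξhat = (N : ℝ)⁻¹ * ∑ i, f (ξhat i) := by
  rw [empirical_eq_discreteMeasure hN, integral_discreteMeasure fun _ => by positivity,
    Finset.mul_sum]

lemma integrable_empirical (hN : 0 < N) (ξhat : Fin N → Fin m → ℝ) (f : (Fin m → ℝ) → ℝ) :
    Integrable f (empirical ξhat) := by
  rw [empirical_eq_discreteMeasure hN]
  exact integrable_discreteMeasure _ _ _

lemma sub_empiricalMean_dotProduct (hN : 0 < N) (ξhat : Fin N → Fin m → ℝ) (x : Fin m → ℝ)
    (α : ℝ) : α - empiricalMean ξhat ⬝ᵥ x = (N : ℝ)⁻¹ * ∑ i, (α - ξhat i ⬝ᵥ x) := by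
  have : (N : ℝ) ≠ 0 := by exact_mod_cast hN.ne'
  simp [empiricalMean, sum_dotProduct, smul_dotProduct, mul_sub, this]

lemma measurable_dotProduct_const (x : Fin m → ℝ) : Measurable fun ξ : Fin m → ℝ => ξ ⬝ᵥ x := by
  unfold dotProduct
  fun_prop

/-! ### Weak duality -/

/-- The Lagrangian integrand has slopes `γ` and `γ + 1` along `x`, hence is Lipschitz for the
`p`-norm with the constant allowed by the two conic constraints. -/
lemma lagrangian_sub_le {p q : ℝ≥0∞} (hpq : ENNReal.HolderConjugate p q) {x : Fin m → ℝ}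
    {γ : ℝ × ℝ} (hγ : γ ∈ conicFeasible q x) (α : ℝ) (ξ η : Fin m → ℝ) :
    (max 0 (α - ξ ⬝ᵥ x) + γ.1 * (α - ξ ⬝ᵥ x)) - (max 0 (α - η ⬝ᵥ x) + γ.1 * (α - η ⬝ᵥ x))
      ≤ γ.2 * pNorm p (ξ - η) := by
  have : Fact (1 ≤ p) := ⟨ENNReal.HolderConjugate.one_le p q⟩
  have key (s : ℝ) (hs : pNorm q (s • x) ≤ γ.2) :
      s * (α - ξ ⬝ᵥ x) - s * (α - η ⬝ᵥ x) ≤ γ.2 * pNorm p (ξ - η) := by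
    calc s * (α - ξ ⬝ᵥ x) - s * (α - η ⬝ᵥ x) = (η - ξ) ⬝ᵥ (s • x) := by
          rw [dotProduct_smul, sub_dotProduct, smul_eq_mul]; ring
      _ ≤ pNorm p (η - ξ) * pNorm q (s • x) := dotProduct_le_pNorm_mul_pNorm hpq _ _
      _ = pNorm q (s • x) * pNorm p (ξ - η) := by
          rw [← neg_sub ξ η, ← neg_one_smul ℝ, pNorm_smul, abs_neg, abs_one, one_mul, mul_comm]
      _ ≤ _ := mul_le_mul_of_nonneg_right hs (pNorm_nonneg _)
  have h0 := key γ.1 hγ.1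
  have h1 := key (γ.1 + 1) (by rw [add_smul, one_smul]; exact hγ.2)
  -- the slope `γ.1` or `γ.1 + 1` to use is decided by the sign of `α - ξ ⬝ᵥ x`
  rcases le_total 0 (α - ξ ⬝ᵥ x) with h | h
  · rw [max_eq_right h]
    linarith [le_max_right 0 (α - η ⬝ᵥ x)]
  · rw [max_eq_left h]
    linarith [le_max_left 0 (α - η ⬝ᵥ x)]

lemma integrable_dotProduct {p q : ℝ≥0∞} (hpq : ENNReal.HolderConjugate p q)
    {P : Measure (Fin m → ℝ)} (hP : P ∈ probMeasures m p) (x : Fin m → ℝ) :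
    Integrable (fun ξ => ξ ⬝ᵥ x) P := by
  have : Fact (1 ≤ p) := ⟨ENNReal.HolderConjugate.one_le p q⟩
  refine (hP.2.mul_const (pNorm q x)).mono' (measurable_dotProduct_const x).aestronglyMeasurable
    (.of_forall fun ξ => abs_le.2 ⟨?_, dotProduct_le_pNorm_mul_pNorm hpq _ _⟩)
  have := dotProduct_le_pNorm_mul_pNorm hpq ((-1 : ℝ) • ξ) x
  rw [pNorm_smul, abs_neg, abs_one, one_mul, smul_dotProduct, smul_eq_mul] at this
  linarith

lemma integral_max_le_conicObjective (hN : 0 < N) {p q : ℝ≥0∞}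
    (hpq : ENNReal.HolderConjugate p q) {ξhat : Fin N → Fin m → ℝ} {ε : ℝ} (hε : 0 ≤ ε)
    {x : Fin m → ℝ} {α : ℝ} {P : Measure (Fin m → ℝ)} (hP : P ∈ innerFeasible p ξhat ε x α)
    {γ : ℝ × ℝ} (hγ : γ ∈ conicFeasible q x) :
    ∫ ξ, max 0 (α - ξ ⬝ᵥ x) ∂P ≤ conicObjective ξhat ε x α γ := by
  have : Fact (1 ≤ p) := ⟨ENNReal.HolderConjugate.one_le p q⟩
  have := hpq.symm
  have : Fact (1 ≤ q) := ⟨ENNReal.HolderConjugate.one_le q p⟩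
  obtain ⟨⟨hPM, hW⟩, hmean⟩ := hP
  have := hPM.1
  have hγ2 : 0 ≤ γ.2 := (pNorm_nonneg _).trans hγ.1
  set t : (Fin m → ℝ) → ℝ := fun ξ => α - ξ ⬝ᵥ x with ht
  set h : (Fin m → ℝ) → ℝ := fun ξ => max 0 (t ξ) + γ.1 * t ξ with hh
  have htm : Measurable t := (measurable_dotProduct_const x).const_sub α
  have hhm : Measurable h := (measurable_const.max htm).add (htm.const_mul _)
  have htP : Integrable t P := (integrable_const α).sub (integrable_dotProduct hpq hPM x)
  have htP' : Integrable (fun ξ => max 0 (t ξ)) P := (integrable_zero _ _ _).sup htP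
  have hhP : Integrable h P := htP'.add (htP.const_mul _)
  have ht0 : ∫ ξ, t ξ ∂P = 0 := by
    rw [ht, integral_sub (integrable_const α) (integrable_dotProduct hpq hPM x), hmean]
    simp
  have hval : ∫ ξ, max 0 (t ξ) ∂P = ∫ ξ, h ξ ∂P := by
    rw [hh, integral_add htP' (htP.const_mul _), integral_const_mul, ht0, mul_zero, add_zero]
  have hemp : ∫ ξ, h ξ ∂empirical ξhat = γ.1 * (α - empiricalMean ξhat ⬝ᵥ x)
      + (N : ℝ)⁻¹ * ∑ i, max 0 (α - ξhat i ⬝ᵥ x) := by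
    rw [integral_empirical hN, sub_empiricalMean_dotProduct hN, Finset.sum_add_distrib,
      ← Finset.mul_sum]
    ring
  refine le_of_forall_pos_le_add fun r hr => ?_
  -- an almost optimal coupling, with `r` split so that `γ.2` times the excess stays below `r`
  have hr' : 0 < r / (γ.2 + 1) := by positivity
  have hlt : wasserstein p P (empirical ξhat) < ENNReal.ofReal (ε + r / (γ.2 + 1)) :=
    hW.trans_lt ((ENNReal.ofReal_lt_ofReal_iff (by positivity)).2 (by linarith))
  simp only [wasserstein, iInf_lt_iff] at hlt
  obtain ⟨Q, ⟨hQ, hQ1, hQ2⟩, hcost⟩ := hlt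
  have hcm : Measurable fun z : (Fin m → ℝ) × (Fin m → ℝ) => pNorm p (z.1 - z.2) :=
    continuous_pNorm.measurable.comp (measurable_fst.sub measurable_snd)
  have hc0 : 0 ≤ᵐ[Q] fun z => pNorm p (z.1 - z.2) := .of_forall fun z => pNorm_nonneg _
  have hci : Integrable (fun z => pNorm p (z.1 - z.2)) Q :=
    (lintegral_ofReal_ne_top_iff_integrable hcm.aestronglyMeasurable hc0).1
      (hcost.trans ENNReal.ofReal_lt_top).ne
  have hcost' : ∫ z, pNorm p (z.1 - z.2) ∂Q ≤ ε + r / (γ.2 + 1) := by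
    rw [integral_eq_lintegral_of_nonneg_ae hc0 hcm.aestronglyMeasurable]
    exact ENNReal.toReal_le_of_le_ofReal (by positivity) hcost.le
  have hi1 : Integrable (fun z => h z.1) Q := by
    rw [← hQ1] at hhP; exact hhP.comp_measurable measurable_fst
  have hi2 : Integrable (fun z => h z.2) Q := by
    have := integrable_empirical hN ξhat h
    rw [← hQ2] at this; exact this.comp_measurable measurable_snd
  have hdiff : ∫ ξ, h ξ ∂P - ∫ ξ, h ξ ∂empirical ξhat ≤ γ.2 * (ε + r / (γ.2 + 1)) := by
    calc ∫ ξ, h ξ ∂P - ∫ ξ, h ξ ∂empirical ξhat = ∫ z, (h z.1 - h z.2) ∂Q := by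
          rw [integral_sub hi1 hi2, ← hQ1, ← hQ2,
            integral_map measurable_fst.aemeasurable hhm.aestronglyMeasurable,
            integral_map measurable_snd.aemeasurable hhm.aestronglyMeasurable]
      _ ≤ ∫ z, γ.2 * pNorm p (z.1 - z.2) ∂Q :=
          integral_mono (hi1.sub hi2) (hci.const_mul _) fun z => lagrangian_sub_le hpq hγ α z.1 z.2
      _ ≤ _ := by rw [integral_const_mul]; exact mul_le_mul_of_nonneg_left hcost' hγ2
  have hexc : γ.2 * (r / (γ.2 + 1)) ≤ r := by
    rw [← mul_div_assoc, div_le_iff₀ (by positivity)]; nlinarith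
  rw [hval, conicObjective]
  linarith

/-! ### Perturbing the empirical distribution -/

/-- Every atom `ξhat i` gives a share `η` of its mass to `ξhat i - (U / η) • v` and a share `η` to
`ξhat i + (D / η) • v`. The transport cost is at most `U + D` whatever `η` is, the mean moves by
`(D - U) • v`, and as `η → 0` the far moves in direction `-v` raise the expected shortfall by
almost `U * (v ⬝ᵥ x)`. -/
lemma exists_innerFeasible_le_integral (hN : 0 < N) {p : ℝ≥0∞} [Fact (1 ≤ p)]
    (ξhat : Fin N → Fin m → ℝ) {ε : ℝ} {x v : Fin m → ℝ} {α U D η : ℝ} (hv : pNorm p v ≤ 1)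
    (hU : 0 ≤ U) (hD : 0 ≤ D) (hUD : U + D = ε)
    (hshift : α - empiricalMean ξhat ⬝ᵥ x = (D - U) * (v ⬝ᵥ x)) (hη : 0 < η) (hη' : η ≤ 1 / 2) :
    ∃ P ∈ innerFeasible p ξhat ε x α,
      (1 - 2 * η) * ((N : ℝ)⁻¹ * ∑ i, max 0 (α - ξhat i ⬝ᵥ x))
        + η * (α - empiricalMean ξhat ⬝ᵥ x) + U * (v ⬝ᵥ x) ≤ ∫ ξ, max 0 (α - ξ ⬝ᵥ x) ∂P := by
  have hN' : (N : ℝ) ≠ 0 := by exact_mod_cast hN.ne'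
  set b : Fin 3 → ℝ := ![1 - 2 * η, η, η] with hb
  set s : Fin 3 → ℝ := ![0, -(U / η), D / η] with hs
  set w : Fin N × Fin 3 → ℝ := fun k => (N : ℝ)⁻¹ * b k.2 with hw
  set y : Fin N × Fin 3 → Fin m → ℝ := fun k => ξhat k.1 + s k.2 • v with hy
  have hb0 (l : Fin 3) : 0 ≤ b l := by
    fin_cases l <;> simp [hb] <;> linarith
  have hw0 (k : Fin N × Fin 3) : 0 ≤ w k := mul_nonneg (by positivity) (hb0 _)
  have hwsum (i : Fin N) : ∑ l, w (i, l) = (N : ℝ)⁻¹ := by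
    rw [hw, ← Finset.mul_sum, Fin.sum_univ_three]
    simp [hb]; ring
  have hw1 : ∑ k, w k = 1 := by
    rw [Fintype.sum_prod_type]; simp [hwsum, hN']
  -- expectations of a function of the point: an average over atoms of a three-term mixture
  have hint (f : (Fin m → ℝ) → ℝ) : ∫ ξ, f ξ ∂discreteMeasure w y = (N : ℝ)⁻¹ * ∑ i,
      ((1 - 2 * η) * f (ξhat i) + η * f (ξhat i + (-(U / η)) • v)
        + η * f (ξhat i + (D / η) • v)) := by
    rw [integral_discreteMeasure hw0, Fintype.sum_prod_type, Finset.mul_sum]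
    refine Finset.sum_congr rfl fun i _ => ?_
    rw [Fin.sum_univ_three]
    simp [hw, hy, hb, hs]; ring
  have hprob := isProbabilityMeasure_discreteMeasure hw0 hw1 y
  have hηne : η ≠ 0 := hη.ne'
  refine ⟨discreteMeasure w y, ⟨⟨⟨hprob, integrable_discreteMeasure _ _ _⟩, ?_⟩, ?_⟩, ?_⟩
  · refine (iInf₂_le (discreteMeasure w fun k => (y k, ξhat k.1))
      ⟨isProbabilityMeasure_discreteMeasure hw0 hw1 _,
        map_discreteMeasure measurable_fst _ _, ?_⟩).trans ?_
    · rw [← ofReal_integral_eq_lintegral_ofReal (integrable_discreteMeasure _ _ _)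
        (.of_forall fun z => pNorm_nonneg _)]
      refine ENNReal.ofReal_le_ofReal ?_
      rw [integral_discreteMeasure hw0]
      have hterm (k : Fin N × Fin 3) :
          w k * pNorm p (y k - ξhat k.1) ≤ (N : ℝ)⁻¹ * (b k.2 * |s k.2|) := by
        simp only [hy, hw, add_sub_cancel_left, pNorm_smul]
        rw [mul_assoc]
        exact mul_le_mul_of_nonneg_left (mul_le_mul_of_nonneg_left
          (mul_le_of_le_one_right (abs_nonneg _) hv) (hb0 _)) (by positivity)
      refine (Finset.sum_le_sum fun k _ => hterm k).trans_eq ?_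
      rw [Fintype.sum_prod_type]
      simp only [← Finset.mul_sum, Fin.sum_univ_three, Finset.sum_const, Finset.card_univ,
        Fintype.card_fin, nsmul_eq_mul]
      simp only [hb, hs, Matrix.cons_val, abs_neg, abs_zero,
        abs_of_nonneg (div_nonneg hU hη.le), abs_of_nonneg (div_nonneg hD hη.le)]
      field_simp
      linarith
    · rw [map_discreteMeasure measurable_snd, empirical_eq_discreteMeasure hN]
      have h := discreteMeasure_comp_fst hw0 ξhat
      simp only [hwsum] at h
      exact h
  · rw [hint]
    have hmean := sub_empiricalMean_dotProduct hN ξhat x α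
    rw [hshift] at hmean
    simp only [add_dotProduct, smul_dotProduct, smul_eq_mul]
    have (i : Fin N) : (1 - 2 * η) * (ξhat i ⬝ᵥ x) + η * (ξhat i ⬝ᵥ x + -(U / η) * (v ⬝ᵥ x))
        + η * (ξhat i ⬝ᵥ x + D / η * (v ⬝ᵥ x))
        = α + (D - U) * (v ⬝ᵥ x) - (α - ξhat i ⬝ᵥ x) := by
      field_simp; ring
    simp only [this]
    rw [Finset.sum_sub_distrib, mul_sub, ← hmean]
    simp; field_simp; ring
  · rw [hint, sub_empiricalMean_dotProduct hN]
    have (i : Fin N) : (1 - 2 * η) * max 0 (α - ξhat i ⬝ᵥ x) + η * (α - ξhat i ⬝ᵥ x)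
        + U * (v ⬝ᵥ x) ≤ (1 - 2 * η) * max 0 (α - ξhat i ⬝ᵥ x)
          + η * max 0 (α - (ξhat i + (-(U / η)) • v) ⬝ᵥ x)
          + η * max 0 (α - (ξhat i + (D / η) • v) ⬝ᵥ x) := by
      have h1 : η * (α - ξhat i ⬝ᵥ x) + U * (v ⬝ᵥ x)
          = η * (α - (ξhat i + (-(U / η)) • v) ⬝ᵥ x) := by
        rw [add_dotProduct, smul_dotProduct, smul_eq_mul]; field_simp; ring
      have h2 := mul_le_mul_of_nonneg_left
        (le_max_right 0 (α - (ξhat i + (-(U / η)) • v) ⬝ᵥ x)) hη.le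
      have h3 := mul_nonneg hη.le (le_max_left 0 (α - (ξhat i + (D / η) • v) ⬝ᵥ x))
      linarith
    refine le_trans (le_of_eq ?_) (mul_le_mul_of_nonneg_left
      (Finset.sum_le_sum fun i _ => this i) (by positivity : 0 ≤ (N : ℝ)⁻¹))
    simp only [Finset.sum_add_distrib, ← Finset.mul_sum]
    simp
    field_simp

/-! ### The finite-dimensional program -/

lemma convexOn_conicObjective {q : ℝ≥0∞} [Fact (1 ≤ q)] (ξhat : Fin N → Fin m → ℝ) (ε : ℝ)
    (x : Fin m → ℝ) (α : ℝ) : ConvexOn ℝ (conicFeasible q x) (conicObjective ξhat ε x α) := by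
  have hc (c : Fin m → ℝ) : Convex ℝ {γ : ℝ × ℝ | pNorm q (γ.1 • x + c) ≤ γ.2} := by
    intro γ hγ δ hδ a b ha hb hab
    calc pNorm q ((a • γ + b • δ).1 • x + c)
        = pNorm q (a • (γ.1 • x + c) + b • (δ.1 • x + c)) := by
          congr 1
          ext i
          simp only [Prod.fst_add, Prod.smul_fst, Pi.add_apply, Pi.smul_apply, smul_eq_mul]
          linear_combination (-c i) * hab
      _ ≤ a * pNorm q (γ.1 • x + c) + b * pNorm q (δ.1 • x + c) :=
          convexOn_pNorm.2 trivial trivial ha hb hab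
      _ ≤ (a • γ + b • δ).2 :=
          add_le_add (mul_le_mul_of_nonneg_left hγ ha) (mul_le_mul_of_nonneg_left hδ hb)
  refine ⟨?_, fun γ _ δ _ a b _ _ hab => le_of_eq ?_⟩
  · have h := (hc 0).inter (hc x)
    simp only [add_zero] at h
    exact h
  · simp only [conicObjective, Prod.fst_add, Prod.snd_add, Prod.smul_fst, Prod.smul_snd,
      smul_eq_mul]
    linear_combination (-((N : ℝ)⁻¹ * ∑ i, max 0 (α - ξhat i ⬝ᵥ x))) * hab

lemma mem_conicFeasible {q : ℝ≥0∞} [Fact (1 ≤ q)] {x : Fin m → ℝ} {g c : ℝ} (h0 : |g| ≤ c)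
    (h1 : |g + 1| ≤ c) : (g, pNorm q x * c) ∈ conicFeasible q x := by
  constructor
  · rw [pNorm_smul, mul_comm]
    exact mul_le_mul_of_nonneg_left h0 (pNorm_nonneg _)
  · have : (g, pNorm q x * c).1 • x + x = (g + 1) • x := by rw [add_smul, one_smul]
    rw [this, pNorm_smul, mul_comm]
    exact mul_le_mul_of_nonneg_left h1 (pNorm_nonneg _)

/-- If the mean constraint cannot be met within the transport budget, letting `γ₁ → ±∞` drives the
objective of the finite-dimensional program to `-∞`. -/
lemma conicValue_eq_bot {q : ℝ≥0∞} [Fact (1 ≤ q)] {ξhat : Fin N → Fin m → ℝ} {ε : ℝ}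
    {x : Fin m → ℝ} {α : ℝ} (h : ε * pNorm q x < |α - empiricalMean ξhat ⬝ᵥ x|) :
    conicValue q ξhat ε x α = ⊥ := by
  refine (EReal.eq_bot_iff_forall_lt _).2 fun r => ?_
  suffices ∃ γ ∈ conicFeasible q x, conicObjective ξhat ε x α γ < r by
    obtain ⟨γ, hγ, hr⟩ := this
    exact (iInf₂_le γ hγ).trans_lt (EReal.coe_lt_coe_iff.2 hr)
  set δ := α - empiricalMean ξhat ⬝ᵥ x with hδ
  set a := pNorm q x
  set C := (N : ℝ)⁻¹ * ∑ i, max 0 (α - ξhat i ⬝ᵥ x) with hC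
  rcases lt_abs.1 h with h | h
  · obtain ⟨K, hK⟩ := exists_nat_gt ((C - r) / (δ - ε * a))
    rw [div_lt_iff₀ (sub_pos.2 h)] at hK
    have hK0 : (0 : ℝ) ≤ K := K.cast_nonneg
    refine ⟨(-(K + 1), a * (K + 1)), mem_conicFeasible ?_ ?_, ?_⟩
    · rw [abs_neg, abs_of_nonneg (by positivity)]
    · rw [abs_le]; constructor <;> linarith
    · simp only [conicObjective, ← hδ, ← hC]
      linarith
  · obtain ⟨K, hK⟩ := exists_nat_gt ((C + a * ε - r) / (-δ - ε * a))
    rw [div_lt_iff₀ (sub_pos.2 h)] at hK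
    have hK0 : (0 : ℝ) ≤ K := K.cast_nonneg
    refine ⟨(K, a * (K + 1)), mem_conicFeasible ?_ ?_, ?_⟩
    · rw [abs_of_nonneg hK0]; linarith
    · rw [abs_of_nonneg (by positivity)]
    · simp only [conicObjective, ← hδ, ← hC]
      linarith

/-- The value at `γ = (-1/2, a/2)`, where `a = pNorm q x`: the point at which the slopes `γ₁` and
`γ₁ + 1` balance. -/
lemma conicValue_le {q : ℝ≥0∞} [Fact (1 ≤ q)] (ξhat : Fin N → Fin m → ℝ) (ε : ℝ)
    (x : Fin m → ℝ) (α : ℝ) :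
    conicValue q ξhat ε x α ≤ (((N : ℝ)⁻¹ * ∑ i, max 0 (α - ξhat i ⬝ᵥ x)
      + (ε * pNorm q x - (α - empiricalMean ξhat ⬝ᵥ x)) / 2 : ℝ) : EReal) := by
  refine (iInf₂_le (-1 / 2, pNorm q x * (1 / 2))
    (mem_conicFeasible (by norm_num [abs_le]) (by norm_num [abs_le]))).trans_eq ?_
  rw [conicObjective]
  congr 1
  ring

/-! ### Strong duality -/

lemma conicValue_le_innerValue (hN : 0 < N) {p q : ℝ≥0∞} (hpq : ENNReal.HolderConjugate p q)
    (ξhat : Fin N → Fin m → ℝ) {ε : ℝ} (hε : 0 ≤ ε) (x : Fin m → ℝ) (α : ℝ) :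
    conicValue q ξhat ε x α ≤ innerValue p ξhat ε x α := by
  have : Fact (1 ≤ p) := ⟨ENNReal.HolderConjugate.one_le p q⟩
  have := hpq.symm
  have : Fact (1 ≤ q) := ⟨ENNReal.HolderConjugate.one_le q p⟩
  rcases lt_or_ge (ε * pNorm q x) |α - empiricalMean ξhat ⬝ᵥ x| with h | h
  · rw [conicValue_eq_bot h]; exact bot_le
  refine (conicValue_le ξhat ε x α).trans ?_
  obtain ⟨v, hv, hvx⟩ := exists_pNorm_le_one_dotProduct_eq hpq x
  set δ := α - empiricalMean ξhat ⬝ᵥ x with hδ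
  set a := pNorm q x
  set C := (N : ℝ)⁻¹ * ∑ i, max 0 (α - ξhat i ⬝ᵥ x)
  have ha : 0 ≤ a := pNorm_nonneg _
  -- when `a = 0` the budget forces `δ = 0`, and then `δ / a = 0` is the right value
  have hδa : δ / a * a = δ := by
    rcases eq_or_ne a 0 with ha0 | ha0
    · rw [ha0, mul_zero] at h
      rw [abs_nonpos_iff.1 h, zero_div, zero_mul]
    · exact div_mul_cancel₀ _ ha0
  have hbd : |δ / a| ≤ ε := by
    rw [abs_div, abs_of_nonneg ha]
    exact div_le_of_le_mul₀ ha hε h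
  obtain ⟨hbd1, hbd2⟩ := abs_le.1 hbd
  set U := (ε - δ / a) / 2 with hU
  set D := (ε + δ / a) / 2 with hD
  have hlim : Filter.Tendsto (fun η : ℝ => (((1 - 2 * η) * C + η * δ + U * a : ℝ) : EReal))
      (nhdsWithin 0 (Set.Ioi 0)) (nhds ((C + (ε * a - δ) / 2 : ℝ) : EReal)) := by
    have hcont : Continuous fun η : ℝ => (((1 - 2 * η) * C + η * δ + U * a : ℝ) : EReal) :=
      continuous_coe_real_ereal.comp (by fun_prop)
    convert (hcont.tendsto 0).mono_left nhdsWithin_le_nhds using 3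
    rw [hU]
    linear_combination (1 / 2) * hδa
  refine le_of_tendsto hlim ?_
  filter_upwards [Ioc_mem_nhdsGT (by norm_num : (0 : ℝ) < 1 / 2)] with η hη
  obtain ⟨P, hP, hPle⟩ := exists_innerFeasible_le_integral hN ξhat (ε := ε) (α := α) (U := U)
    (D := D) hv (by linarith) (by linarith) (by rw [hU, hD]; ring)
    (by rw [hvx, ← hδ, hU, hD]; linear_combination -hδa) hη.1 hη.2
  rw [hvx] at hPle
  exact (EReal.coe_le_coe_iff.2 hPle).trans (le_iSup₂_of_le P hP le_rfl)

end DRO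

theorem theoremA1 {m N : ℕ} (hN : 0 < N) (p q : ℝ≥0∞) (hpq : ENNReal.HolderConjugate p q)
    (ξhat : Fin N → Fin m → ℝ) (ε : ℝ) (hε : 0 ≤ ε) (x : Fin m → ℝ) (α : ℝ) :
    ConvexOn ℝ (DRO.conicFeasible q x) (DRO.conicObjective ξhat ε x α) ∧
      DRO.innerValue p ξhat ε x α = DRO.conicValue q ξhat ε x α := by
  have := hpq.symm
  have : Fact (1 ≤ q) := ⟨ENNReal.HolderConjugate.one_le q p⟩
  refine ⟨DRO.convexOn_conicObjective ξhat ε x α, le_antisymm ?_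
    (DRO.conicValue_le_innerValue hN hpq ξhat hε x α)⟩
  exact iSup₂_le fun P hP => le_iInf₂ fun γ hγ =>
    EReal.coe_le_coe_iff.2 (DRO.integral_max_le_conicObjective hN hpq hε hP hγ)
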